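/- All Banach spaces are real. Let $K$ be a compact Hausdorff space together with a lower semicontinuous metric $d$ on $K$, that is, a metric $d:K\times K\to[0,\infty)$ that is lower semicontinuous for the product topology of $K\times K$. Let $C(K)$ be the space of real functions on $K$ that are continuous for the compact topology, with the supremum norm; a function or map is called Lipschitz if it is Lipschitz for the metric(s) $d$. We say that $C(K)$ is isometrically (resp. isomorphically) Lipschitz universal for the separable Banach spaces if for every separable Banach space $X$ there is a linear isometric (resp. isomorphic, i.e. bounded linear and bounded below) embedding $J:X\to C(K)$ such that $J(x)$ is a Lipschitz function for every $x\in X$. Let $\Delta=\{0,1\}^{\mathbb N}$ be the Cantor space with its product topology, together with the discrete metric (distance $1$ between distinct points). Then $C(\Delta)$ is isometrically Lipschitz universal for the separable Banach spaces. Conversely, if $K$ is a metrizable compact space with a lower semicontinuous metric $d$ such that $C(K)$ is isomorphically Lipschitz universal for the separable Banach spaces, then there is a subset $H\subset K$ equivalent to $\Delta$: there is a bijection $\varphi:H\to\Delta$ that is a homeomorphism for the topologies and such that both $\varphi$ and $\varphi^{-1}$ are Lipschitz, where $H$ carries the topology of $K$ and the restriction of $d$ and $\Delta$ carries the product topology and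 the discrete metric. -/

import Mathlib

universe u v

/-- A lower semicontinuous metric on a topological space `K`: a metric `d : K × K → [0, ∞)`, in
general unrelated to the topology of `K` otherwise, which is lower semicontinuous on `K × K` for the
product of the given topology. (Non-negativity follows from the other axioms.) -/
structure LscMetric (K : Type*) [TopologicalSpace K] where
  /-- the distance function -/
  d : K → K → ℝ
  d_self : ∀ x, d x x = 0
  eq_of_d_eq_zero : ∀ x y, d x y = 0 → x = y
  d_comm : ∀ x y, d x y = d y x
  d_triangle : ∀ x y z, d x z ≤ d x y + d y z
  lsc : LowerSemicontinuous fun p : K × K => d p.1 p.2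

namespace LscMetric

/-- The discrete metric, taking the value `1` at all pairs of distinct points. -/
noncomputable def discrete (K : Type*) [TopologicalSpace K] [T2Space K] : LscMetric K where
  d x y := open Classical in if x = y then 0 else 1
  d_self x := by simp
  eq_of_d_eq_zero x y h := by
    by_contra hne
    simp [hne] at h
  d_comm x y := by
    by_cases h : x = y
    · rw [h]
    · rw [if_neg h, if_neg (Ne.symm h)]
  d_triangle x y z := by
    by_cases h₁ : x = y
    · subst h₁
      simp
    · have h₂ : (0 : ℝ) ≤ (open Classical in if y = z then (0 : ℝ) else 1) := by
        split_ifs <;> norm_num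
      have h₃ : (open Classical in if x = z then (0 : ℝ) else 1) ≤ 1 := by
        split_ifs <;> norm_num
      rw [if_neg h₁]
      linarith
  lsc := by
    intro p c hc
    by_cases h : p.1 = p.2
    · refine Filter.Eventually.of_forall fun q => ?_
      have hc' : c < 0 := by simpa only [if_pos h] using hc
      change c < (open Classical in if q.1 = q.2 then (0 : ℝ) else 1)
      split_ifs <;> linarith
    · simp only [if_neg h] at hc
      have ho : IsOpen {q : K × K | q.1 ≠ q.2} := isOpen_ne_fun continuous_fst continuous_snd
      filter_upwards [ho.mem_nhds h] with q hq
      simpa only [if_neg hq] using hc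

/-- The restriction of a lower semicontinuous metric to a subset with the subspace topology. -/
def restrict {K : Type*} [TopologicalSpace K] (m : LscMetric K) (H : Set K) : LscMetric H where
  d x y := m.d x y
  d_self x := m.d_self x
  eq_of_d_eq_zero x y h := Subtype.ext (m.eq_of_d_eq_zero x y h)
  d_comm x y := m.d_comm x y
  d_triangle x y z := m.d_triangle x y z
  lsc := m.lsc.comp (g := fun p : H × H => ((p.1 : K), (p.2 : K))) (by fun_prop)

/-- A real function is Lipschitz with respect to `m` (its Lipschitz constant is finite). -/
def IsLipschitzFun {K : Type*} [TopologicalSpace K] (m : LscMetric K) (f : K → ℝ) : Prop :=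
  ∃ L : ℝ, ∀ s t, |f s - f t| ≤ L * m.d s t

/-- A map between two spaces is Lipschitz with respect to the given metrics. -/
def IsLipschitzMap {K₁ K₂ : Type*} [TopologicalSpace K₁] [TopologicalSpace K₂]
    (m₁ : LscMetric K₁) (m₂ : LscMetric K₂) (φ : K₁ → K₂) : Prop :=
  ∃ L : ℝ, ∀ s t, m₂.d (φ s) (φ t) ≤ L * m₁.d s t

/-- Equivalence of spaces with lower semicontinuous metrics: there is a bijection which is at the
same time a homeomorphism for the topologies and a Lipschitz isomorphism for the metrics. -/
def Equivalent {K₁ K₂ : Type*} [TopologicalSpace K₁] [TopologicalSpace K₂]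
    (m₁ : LscMetric K₁) (m₂ : LscMetric K₂) : Prop :=
  ∃ φ : K₁ ≃ₜ K₂, IsLipschitzMap m₁ m₂ φ ∧ IsLipschitzMap m₂ m₁ φ.symm

/-- `C(K)` (continuity for the topology of `K`, supremum norm) contains a linearly isometric copy of
`X` consisting of functions that are Lipschitz for the metric. -/
def ContainsIsometricLipschitzCopy {K : Type*} [TopologicalSpace K] [CompactSpace K]
    (m : LscMetric K) (X : Type*) [NormedAddCommGroup X] [NormedSpace ℝ X] : Prop :=
  ∃ J : X →ₗᵢ[ℝ] C(K, ℝ), ∀ x : X, m.IsLipschitzFun (J x)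

/-- `C(K)` (continuity for the topology of `K`, supremum norm) contains a linearly isomorphic copy of
`X` consisting of functions that are Lipschitz for the metric. -/
def ContainsIsomorphicLipschitzCopy {K : Type*} [TopologicalSpace K] [CompactSpace K]
    (m : LscMetric K) (X : Type*) [NormedAddCommGroup X] [NormedSpace ℝ X] : Prop :=
  ∃ J : X →L[ℝ] C(K, ℝ),
    (∃ c : ℝ, 0 < c ∧ ∀ x : X, c * ‖x‖ ≤ ‖J x‖) ∧ ∀ x : X, m.IsLipschitzFun (J x)

/-- `C(K)` is isometrically Lipschitz universal for the separable (real) Banach spaces. -/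
def IsometricLipschitzUniversal {K : Type v} [TopologicalSpace K] [CompactSpace K]
    (m : LscMetric K) : Prop :=
  ∀ (X : Type u) [NormedAddCommGroup X] [NormedSpace ℝ X] [CompleteSpace X]
    [TopologicalSpace.SeparableSpace X], m.ContainsIsometricLipschitzCopy X

/-- `C(K)` is isomorphically Lipschitz universal for the separable (real) Banach spaces. -/
def IsomorphicLipschitzUniversal {K : Type v} [TopologicalSpace K] [CompactSpace K]
    (m : LscMetric K) : Prop :=
  ∀ (X : Type u) [NormedAddCommGroup X] [NormedSpace ℝ X] [CompleteSpace X]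
    [TopologicalSpace.SeparableSpace X], m.ContainsIsomorphicLipschitzCopy X

end LscMetric

/-- The Cantor space `{0,1}^ℕ`, with the product topology. -/
abbrev CantorSpace : Type := ℕ → Bool

/-- The discrete metric on the Cantor space. -/
noncomputable abbrev cantorMetric : LscMetric CantorSpace := LscMetric.discrete CantorSpace

/-! Universality of the Cantor space is Banach-Mazur, because bounded functions are Lipschitz for
the discrete metric.

The converse uses only one copy `J` of `C(CantorSpace, ℝ)` in `C(K)`. Let cylinders shrink to a
point `s`. The images of their indicators cannot tend to zero pointwise on `K`: convex combinations
of the indicators equal `1` at `s`, while a bounded pointwise null sequence has convex combinations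
of small norm. So for some `t s` in `K` the functional `f ↦ J f (t s)` has an atom at `s`
(`exists_frequently_le_abs_apply`). A functional has finitely many atoms of a given size
(`finite_setOf_frequently_le_abs`), so among uncountably many `s` with atoms of uniform size, each
`t s` is separated from all but finitely many others by some `J f` with `‖f‖ ≤ 1`. This separation
is an open relation, so a Cantor scheme gives a Cantor set of pairwise separated points
(`exists_cantor_pairwise_related`). The uniform Lipschitz bound on `J` turns separation into a lower
bound for `d`; working inside a closed `d`-ball gives the upper bound. -/

open Set Filter Topology

/-! ### Convex combinations of pointwise null sequences -/

/-- A bounded sequence of continuous functions on a compact space which converges pointwise to zero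
has convex combinations of arbitrarily small norm. -/
theorem exists_mem_convexHull_norm_lt {K : Type*} [TopologicalSpace K] [CompactSpace K] [T2Space K]
    (u : ℕ → C(K, ℝ)) (M : ℝ) (hM : ∀ n x, |u n x| ≤ M)
    (hu : ∀ x, Tendsto (fun n => u n x) atTop (𝓝 0)) {c : ℝ} (hc : 0 < c) :
    ∃ v ∈ convexHull ℝ (range u), ‖v‖ < c := by
  by_contra! hcon
  -- Dominating `|v|` and bounding only from above in `B` make the separating functional positive.
  -- It is then integration against a measure, and dominated convergence sends its values at `|u n|`
  -- to `0`, although they are at least `s > 0`.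
  let A : Set C(K, ℝ) := {g | ∃ v ∈ convexHull ℝ (range u), ∀ x, |v x| ≤ g x}
  let B : Set C(K, ℝ) := {g | ∀ x, g x < c}
  have hA : Convex ℝ A := by
    rintro g ⟨v, hv, hvg⟩ g' ⟨v', hv', hvg'⟩ a b ha hb hab
    refine ⟨a • v + b • v', convex_convexHull ℝ _ hv hv' ha hb hab, fun x => ?_⟩
    calc |a * v x + b * v' x| ≤ |a * v x| + |b * v' x| := abs_add_le _ _
      _ = a * |v x| + b * |v' x| := by rw [abs_mul, abs_mul, abs_of_nonneg ha, abs_of_nonneg hb]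
      _ ≤ a * g x + b * g' x := by
        gcongr
        · exact hvg x
        · exact hvg' x
  have hB : Convex ℝ B := by
    intro g hg g' hg' a b ha hb hab x
    exact (convex_Iio c) (hg x) (hg' x) ha hb hab
  have hBo : IsOpen B := by
    have := ContinuousMap.isOpen_setOfPred_mapsTo (X := K) (Y := ℝ) isCompact_univ (isOpen_Iio (a := c))
    convert this using 1
    ext g
    simp [B, MapsTo]
  have hdisj : Disjoint B A := by
    rw [Set.disjoint_left]
    rintro g hg ⟨v, hv, hvg⟩
    refine (hcon v hv).not_gt ?_
    rw [ContinuousMap.norm_lt_iff _ hc]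
    exact fun x => (hvg x).trans_lt (hg x)
  obtain ⟨φ, s, hφB, hφA⟩ := geometric_hahn_banach_open hB hBo hA hdisj
  have hs : 0 < s := by simpa using hφB 0 (fun x => by simpa using hc)
  have hpos : ∀ f : C(K, ℝ), (∀ x, 0 ≤ f x) → 0 ≤ φ f := by
    intro f hf
    by_contra! hneg
    -- If `φ f < 0`, this multiple of `f` is nonpositive, hence in `B`, yet `φ` takes the value `s`
    -- there.
    have := hφB ((s / φ f) • f) (fun x => by
      have : s / φ f * f x ≤ 0 :=
        mul_nonpos_of_nonpos_of_nonneg (div_nonpos_of_nonneg_of_nonpos hs.le hneg.le) (hf x)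
      simpa using this.trans_lt hc)
    rw [map_smul, smul_eq_mul, div_mul_cancel₀ _ hneg.ne] at this
    exact this.false
  let : MeasurableSpace K := borel K
  have : BorelSpace K := ⟨rfl⟩
  let Λ : CompactlySupportedContinuousMap K ℝ →ₚ[ℝ] ℝ :=
    { toFun := fun g => φ (g : C(K, ℝ))
      map_add' := fun g g' => map_add φ (g : C(K, ℝ)) (g' : C(K, ℝ))
      map_smul' := fun a g => map_smul φ a (g : C(K, ℝ))
      monotone' := fun g g' h => by
        have := hpos ((g' : C(K, ℝ)) - (g : C(K, ℝ))) (fun x => sub_nonneg.2 (h x))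
        rw [map_sub] at this
        exact sub_nonneg.1 this }
  have hint : ∀ f : C(K, ℝ), ∫ x, f x ∂(RealRMK.rieszMeasure Λ) = φ f := fun f =>
    RealRMK.integral_rieszMeasure Λ (CompactlySupportedContinuousMap.continuousMapEquiv f)
  have hlim : Tendsto (fun n => ∫ x, |u n x| ∂(RealRMK.rieszMeasure Λ)) atTop (𝓝 0) := by
    have := MeasureTheory.tendsto_integral_of_dominated_convergence
      (μ := RealRMK.rieszMeasure Λ) (F := fun n x => |u n x|) (f := fun _ => (0 : ℝ))
      (fun _ => M) (fun n => by
        exact ((u n).continuous.abs).aestronglyMeasurable)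
      (MeasureTheory.integrable_const M)
      (fun n => Eventually.of_forall fun x => by simpa using hM n x)
      (Eventually.of_forall fun x => by simpa using (hu x).abs)
    simpa using this
  refine hs.not_ge (ge_of_tendsto' hlim fun n => ?_)
  have h := hφA |u n| ⟨u n, subset_convexHull ℝ _ (mem_range_self n), fun x => by simp⟩
  rw [← hint] at h
  simpa using h

/-! ### Cantor schemes for an open relation -/

/-- Two closed pieces of small diameter which are related to each other, each containing uncountably
many terms of a family, inside a closed set containing uncountably many terms of the family. -/
theorem exists_closed_small_splitting {α ι : Type*} [MetricSpace α] [SecondCountableTopology α]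
    (t : ι → α) {R : Set (α × α)} (hR : IsOpen R)
    (hcount : ∀ i, {j | (t i, t j) ∉ R}.Countable) {C : Set α} (hC : IsClosed C)
    (hbig : ¬ {i | t i ∈ C}.Countable) {ε : ENNReal} (hε : 0 < ε) :
    ∃ E : Bool → Set α, (∀ b, IsClosed (E b) ∧ ¬ {i | t i ∈ E b}.Countable ∧ E b ⊆ C ∧
      Metric.ediam (E b) ≤ ε) ∧ E false ×ˢ E true ⊆ R := by
  -- Indices of condensation points. The remaining ones are covered by countably many basic open
  -- sets, each holding countably many terms.
  let G : Set ι := {i | t i ∈ C ∧ ∀ U ∈ 𝓝 (t i), ¬ {j | t j ∈ C ∩ U}.Countable}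
  have hG : ¬ G.Countable := by
    intro hGc
    apply hbig
    let 𝒰 := {U ∈ TopologicalSpace.countableBasis α | {j | t j ∈ C ∩ U}.Countable}
    have h𝒰 : (⋃ U ∈ 𝒰, {j | t j ∈ C ∩ U}).Countable :=
      Set.Countable.biUnion ((TopologicalSpace.countable_countableBasis α).mono (sep_subset _ _))
        fun U hU => hU.2
    refine (hGc.union h𝒰).mono fun i hi => ?_
    by_cases hiG : i ∈ G
    · exact Or.inl hiG
    · right
      have : ∃ U ∈ 𝓝 (t i), {j | t j ∈ C ∩ U}.Countable := by
        by_contra! h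
        exact hiG ⟨hi, h⟩
      obtain ⟨U, hU, hUc⟩ := this
      obtain ⟨V, hV, hiV, hVU⟩ :=
        (TopologicalSpace.isBasis_countableBasis α).mem_nhds_iff.1 hU
      exact mem_biUnion (show V ∈ 𝒰 from ⟨hV, hUc.mono (preimage_mono (f := t) (inter_subset_inter_right C hVU))⟩)
        (show t i ∈ C ∩ V from ⟨hi, hiV⟩)
  have hne : G.Nonempty := by
    by_contra h
    rw [not_nonempty_iff_eq_empty] at h
    simp [h] at hG
  obtain ⟨i, hi⟩ := hne
  obtain ⟨j, hj, hij⟩ : ∃ j ∈ G, (t i, t j) ∈ R := by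
    by_contra! h
    exact hG ((hcount i).mono fun j hj => h j hj)
  obtain ⟨U, hU, V, hV, hUV⟩ := mem_nhds_prod_iff.1 (hR.mem_nhds hij)
  have small : ∀ (x : α) (W : Set α), W ∈ 𝓝 x →
      ∃ D, IsClosed D ∧ D ∈ 𝓝 x ∧ D ⊆ W ∧ Metric.ediam D ≤ ε := by
    intro x W hW
    have hε2 : 0 < ε / 2 := ENNReal.div_pos hε.ne' (by simp)
    obtain ⟨D, hD, hDc, hDW⟩ := exists_mem_nhds_isClosed_subset
      (inter_mem hW (Metric.eball_mem_nhds x hε2))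
    refine ⟨D, hDc, hD, hDW.trans inter_subset_left, ?_⟩
    calc Metric.ediam D ≤ Metric.ediam (Metric.eball x (ε / 2)) :=
          Metric.ediam_mono (hDW.trans inter_subset_right)
      _ ≤ 2 * (ε / 2) := Metric.ediam_eball_le
      _ = ε := ENNReal.mul_div_cancel (by simp) (by simp)
  obtain ⟨D₀, hD₀c, hD₀, hD₀U, hD₀ε⟩ := small _ _ hU
  obtain ⟨D₁, hD₁c, hD₁, hD₁V, hD₁ε⟩ := small _ _ hV
  refine ⟨fun b => C ∩ cond b D₁ D₀, fun b => ?_, ?_⟩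
  · cases b
    · exact ⟨hC.inter hD₀c, hi.2 _ hD₀, inter_subset_left,
        (Metric.ediam_mono inter_subset_right).trans hD₀ε⟩
    · exact ⟨hC.inter hD₁c, hj.2 _ hD₁, inter_subset_left,
        (Metric.ediam_mono inter_subset_right).trans hD₁ε⟩
  · rintro ⟨x, y⟩ ⟨hx, hy⟩
    exact hUV ⟨hD₀U hx.2, hD₁V hy.2⟩

/-- If every term of an uncountable family is related, by an open symmetric relation, to all but
countably many terms of the family, then there is a Cantor set whose points are pairwise related. -/
theorem exists_cantor_pairwise_related {α ι : Type*} [MetricSpace α] [CompleteSpace α]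
    [SecondCountableTopology α] (t : ι → α) {R : Set (α × α)} (hR : IsOpen R)
    (hsymm : ∀ x y, (x, y) ∈ R → (y, x) ∈ R)
    (hcount : ∀ i, {j | (t i, t j) ∉ R}.Countable) {C : Set α} (hC : IsClosed C)
    (hbig : ¬ {i | t i ∈ C}.Countable) :
    ∃ f : (ℕ → Bool) → α, Continuous f ∧ (∀ x, f x ∈ C) ∧ ∀ x y, x ≠ y → (f x, f y) ∈ R := by
  obtain ⟨u, -, upos, hu⟩ := exists_seq_strictAnti_tendsto' (zero_lt_one' ENNReal)
  let P := {E : Set α // IsClosed E ∧ ¬ {i | t i ∈ E}.Countable}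
  have split : ∀ (E : P) (n : ℕ), ∃ F : Bool → P, (∀ b, (F b).1 ⊆ E.1 ∧
      Metric.ediam (F b).1 ≤ u n) ∧ (F false).1 ×ˢ (F true).1 ⊆ R := by
    intro E n
    obtain ⟨F, hF, hFR⟩ := exists_closed_small_splitting t hR hcount E.2.1 E.2.2 (upos n).1
    exact ⟨fun b => ⟨F b, (hF b).1, (hF b).2.1⟩, fun b => (hF b).2.2, hFR⟩
  choose F hF hFR using split
  -- The newest bit is the head of the list, as in `PiNat.res`.
  let DP : List Bool → P := fun l => List.rec ⟨C, hC, hbig⟩ (fun a l E => F E l.length a) l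
  let D : List Bool → Set α := fun l => (DP l).1
  have hanti : CantorScheme.ClosureAntitone D :=
    CantorScheme.Antitone.closureAntitone (fun l a => (hF (DP l) l.length a).1)
      fun l => (DP l).2.1
  have hdiam : CantorScheme.VanishingDiam D := by
    intro x
    rw [← tendsto_add_atTop_iff_nat 1]
    refine tendsto_of_tendsto_of_tendsto_of_le_of_le tendsto_const_nhds hu (fun _ => zero_le)
      fun n => ?_
    have h : Metric.ediam (D (x n :: PiNat.res x n)) ≤ u (PiNat.res x n).length :=
      (hF (DP (PiNat.res x n)) (PiNat.res x n).length (x n)).2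
    rwa [PiNat.res_length] at h
  have hnonempty : ∀ l, (D l).Nonempty := by
    intro l
    by_contra h
    rw [not_nonempty_iff_eq_empty] at h
    have h2 := (DP l).2.2
    change ¬ {i | t i ∈ D l}.Countable at h2
    simp [h] at h2
  have hdom : ∀ x : ℕ → Bool, x ∈ (CantorScheme.inducedMap D).1 := fun x => by
    rw [hanti.map_of_vanishingDiam hdiam hnonempty]
    apply mem_univ
  have hmem : ∀ x n, (CantorScheme.inducedMap D).2 ⟨x, hdom x⟩ ∈ D (PiNat.res x n) := fun x n =>
    CantorScheme.map_mem ⟨x, hdom x⟩ n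
  refine ⟨fun x => (CantorScheme.inducedMap D).2 ⟨x, hdom x⟩,
    hdiam.map_continuous.comp (by fun_prop), fun x => hmem x 0, fun x y hxy => ?_⟩
  by_contra hnR
  -- At a first differing bit the two points would lie in the two related halves of one piece; so
  -- unrelated points have equal branches.
  refine hxy (PiNat.res_injective (funext fun n => ?_))
  induction n with
  | zero => simp
  | succ n ih =>
    simp only [PiNat.res_succ, List.cons.injEq]
    refine ⟨?_, ih⟩
    by_contra hne
    have hx := hmem x (n + 1)
    have hy := hmem y (n + 1)
    rw [PiNat.res_succ] at hx hy
    rw [← ih] at hy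
    have key := hFR (DP (PiNat.res x n)) (PiNat.res x n).length
    cases hxn : x n <;> cases hyn : y n <;> rw [hxn] at hx <;> rw [hyn] at hy
    · exact hne (hxn.trans hyn.symm)
    · exact hnR (key ⟨hx, hy⟩)
    · exact hnR (hsymm _ _ (key ⟨hy, hx⟩))
    · exact hne (hxn.trans hyn.symm)

/-! ### Atoms of functionals on `C(CantorSpace, ℝ)` -/

/-- The indicator function of a cylinder of the Cantor space. -/
noncomputable def cylinderIndicator (s : CantorSpace) (n : ℕ) : C(CantorSpace, ℝ) where
  toFun := (PiNat.cylinder s n).indicator 1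
  continuous_toFun := by
    refine IsClopen.continuous_indicator ⟨?_, PiNat.isOpen_cylinder _ s n⟩ continuous_one
    rw [PiNat.cylinder_eq_pi]
    exact isClosed_set_pi fun i _ => isClosed_singleton

theorem cylinderIndicator_apply_of_mem {s x : CantorSpace} {n : ℕ} (h : x ∈ PiNat.cylinder s n) :
    cylinderIndicator s n x = 1 := indicator_of_mem h _

theorem cylinderIndicator_apply_of_notMem {s x : CantorSpace} {n : ℕ}
    (h : x ∉ PiNat.cylinder s n) : cylinderIndicator s n x = 0 := indicator_of_notMem h _

theorem norm_cylinderIndicator_le (s : CantorSpace) (n : ℕ) : ‖cylinderIndicator s n‖ ≤ 1 := by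
  rw [ContinuousMap.norm_le _ zero_le_one]
  intro x
  by_cases h : x ∈ PiNat.cylinder s n
  · simp [cylinderIndicator_apply_of_mem h]
  · simp [cylinderIndicator_apply_of_notMem h]

/-- A continuous functional on `C(CantorSpace, ℝ)` has only finitely many atoms of a given size. -/
theorem finite_setOf_frequently_le_abs (ν : C(CantorSpace, ℝ) →L[ℝ] ℝ) {δ : ℝ} (hδ : 0 < δ) :
    {s | ∃ᶠ n in atTop, δ ≤ |ν (cylinderIndicator s n)|}.Finite := by
  by_contra hinf
  -- With `k` atoms, a signed sum of disjoint cylinder indicators has norm at most `1` and `ν`-value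
  -- at least `k * δ > ‖ν‖`.
  obtain ⟨k, hk⟩ := exists_nat_gt (‖ν‖ / δ)
  obtain ⟨T, hT, hTk⟩ := Set.Infinite.exists_subset_card_eq hinf k
  obtain ⟨n₀, hn₀⟩ : ∃ n₀, ∀ s ∈ T, ∀ s' ∈ T, s ≠ s' → s ∉ PiNat.cylinder s' n₀ := by
    have : ∀ᶠ n in atTop, ∀ s ∈ T, ∀ s' ∈ T, s ≠ s' → s ∉ PiNat.cylinder s' n := by
      simp_rw [Filter.eventually_all_finset]
      intro s _ s' _
      by_cases h : s = s'
      · simp [h]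
      · obtain ⟨m, hm⟩ := Function.ne_iff.1 h
        filter_upwards [eventually_gt_atTop m] with n hn _ hmem
        exact hm (hmem m hn)
    exact this.exists
  have hex : ∀ s, ∃ n, s ∈ T → n₀ ≤ n ∧ δ ≤ |ν (cylinderIndicator s n)| := by
    intro s
    by_cases hs : s ∈ T
    · obtain ⟨n, hn⟩ := ((hT hs).and_eventually (eventually_ge_atTop n₀)).exists
      exact ⟨n, fun _ => ⟨hn.2, hn.1⟩⟩
    · exact ⟨0, fun h => absurd h hs⟩
  choose n hn using hex
  let f : C(CantorSpace, ℝ) :=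
    ∑ s ∈ T, ((SignType.sign (ν (cylinderIndicator s (n s))) : SignType) : ℝ) •
      cylinderIndicator s (n s)
  have hf : ‖f‖ ≤ 1 := by
    rw [ContinuousMap.norm_le _ zero_le_one]
    intro x
    have hfx : f x = ∑ s ∈ T, ((SignType.sign (ν (cylinderIndicator s (n s))) : SignType) : ℝ) *
      cylinderIndicator s (n s) x := by simp [f, ContinuousMap.sum_apply]
    rw [hfx]
    by_cases h : ∃ s ∈ T, x ∈ PiNat.cylinder s (n s)
    · obtain ⟨s, hs, hx⟩ := h
      rw [Finset.sum_eq_single_of_mem s hs, cylinderIndicator_apply_of_mem hx, mul_one]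
      · generalize SignType.sign (ν (cylinderIndicator s (n s))) = a
        cases a <;> simp
      · intro s' hs' hne
        rw [cylinderIndicator_apply_of_notMem, mul_zero]
        intro hx'
        refine hn₀ s hs s' hs' hne.symm fun i hi => ?_
        rw [← hx i (hi.trans_le (hn s hs).1), hx' i (hi.trans_le (hn s' hs').1)]
    · push Not at h
      rw [Finset.sum_eq_zero fun s hs => by
        rw [cylinderIndicator_apply_of_notMem (h s hs), mul_zero]]
      simp
  have hνf : k * δ ≤ ν f := by
    have : ν f = ∑ s ∈ T, |ν (cylinderIndicator s (n s))| := by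
      simp [f, map_sum, sign_mul_self]
    rw [this, ← hTk, ← nsmul_eq_mul]
    exact Finset.card_nsmul_le_sum _ _ _ fun s hs => (hn s hs).2
  have h1 : ν f ≤ ‖ν‖ := (le_abs_self _).trans ((ν.le_opNorm f).trans
    (mul_le_of_le_one_right (norm_nonneg _) hf))
  rw [div_lt_iff₀ hδ] at hk
  linarith

/-- Given an isomorphic copy of `C(CantorSpace, ℝ)` in `C(K)`, every point of the Cantor space is an
atom of some evaluation functional. -/
theorem exists_frequently_le_abs_apply {K : Type*} [TopologicalSpace K] [CompactSpace K] [T2Space K]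
    (J : C(CantorSpace, ℝ) →L[ℝ] C(K, ℝ)) {c : ℝ} (hc : 0 < c) (hJ : ∀ f, c * ‖f‖ ≤ ‖J f‖)
    (s : CantorSpace) :
    ∃ t : K, ∃ δ > 0, ∃ᶠ n in atTop, δ ≤ |J (cylinderIndicator s n) t| := by
  by_contra! hcon
  obtain ⟨v, hv, hvc⟩ := exists_mem_convexHull_norm_lt (fun n => J (cylinderIndicator s n)) ‖J‖
    (fun n x => (ContinuousMap.norm_coe_le_norm _ x).trans ((J.le_opNorm _).trans
      (mul_le_of_le_one_right (norm_nonneg _) (norm_cylinderIndicator_le s n))))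
    (fun x => by
      rw [Metric.tendsto_nhds]
      intro δ hδ
      have := hcon x δ hδ
      filter_upwards [this] with n hn
      simpa using hn) hc
  have hrange : range (fun n => J (cylinderIndicator s n)) =
      J.toLinearMap '' range (cylinderIndicator s) := by
    rw [← range_comp]
    rfl
  rw [hrange, ← LinearMap.image_convexHull] at hv
  obtain ⟨w, hw, rfl⟩ := hv
  -- All the indicators equal `1` at `s`, so `‖w‖ ≥ 1`, against `‖J w‖ < c`.
  have hws : w ∈ {f : C(CantorSpace, ℝ) | f s = 1} := by
    refine convexHull_min ?_ ?_ hw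
    · rintro _ ⟨n, rfl⟩
      exact cylinderIndicator_apply_of_mem (PiNat.self_mem_cylinder s n)
    · intro f hf g hg a b _ _ hab
      have hf' : f s = 1 := hf
      have hg' : g s = 1 := hg
      simp [hf', hg', hab]
  have h1 : 1 ≤ ‖w‖ := by
    have := ContinuousMap.norm_coe_le_norm w s
    rw [show w s = 1 from hws] at this
    simpa using this
  have h2 := hJ w
  exact hvc.not_ge ((le_mul_of_one_le_right hc.le h1).trans h2)

/-! ### The Banach-Mazur embedding -/

/-- Banach-Mazur: every separable normed space is isometric to a space of continuous functions on
the Cantor space. -/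
theorem exists_linearIsometry_continuousMap_cantorSpace (X : Type*) [NormedAddCommGroup X]
    [NormedSpace ℝ X] [TopologicalSpace.SeparableSpace X] :
    Nonempty (X →ₗᵢ[ℝ] C(CantorSpace, ℝ)) := by
  -- The weak-* dual ball is compact and metrizable, hence a continuous image of the Cantor space;
  -- evaluation on it is isometric by Hahn-Banach.
  let B : Set (WeakDual ℝ X) := WeakDual.toStrongDual ⁻¹' Metric.closedBall (0 : StrongDual ℝ X) 1
  have hB : IsCompact B := WeakDual.isCompact_closedBall 0 1
  have : CompactSpace B := isCompact_iff_compactSpace.1 hB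
  have : TopologicalSpace.MetrizableSpace B := WeakDual.metrizable_of_isCompact ℝ X B hB
  let := TopologicalSpace.metrizableSpaceMetric B
  have : Nonempty B := ⟨⟨0, by simp [B]⟩⟩
  obtain ⟨q, hq, hqs⟩ := exists_nat_bool_continuous_surjective_of_compact B
  let J : X →ₗ[ℝ] C(CantorSpace, ℝ) :=
    { toFun := fun x => ⟨fun s => (q s : WeakDual ℝ X) x,
        (WeakDual.eval_continuous x).comp (continuous_subtype_val.comp hq)⟩
      map_add' := fun x y => by ext s; exact map_add (q s : WeakDual ℝ X) x y
      map_smul' := fun a x => by ext s; exact map_smul (q s : WeakDual ℝ X) a x }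
  refine ⟨⟨J, fun x => le_antisymm ?_ ?_⟩⟩
  · rw [ContinuousMap.norm_le _ (norm_nonneg _)]
    intro s
    have h1 : ‖WeakDual.toStrongDual (q s : WeakDual ℝ X)‖ ≤ 1 :=
      mem_closedBall_zero_iff.1 (q s).2
    exact (ContinuousLinearMap.le_opNorm _ x).trans
      (mul_le_of_le_one_left (norm_nonneg _) h1)
  · obtain ⟨g, hg, hgx⟩ := exists_dual_vector'' ℝ x
    obtain ⟨s, hs⟩ := hqs ⟨StrongDual.toWeakDual g, by simpa [B] using hg⟩
    have h := ContinuousMap.norm_coe_le_norm (J x) s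
    have h2 : J x s = ‖x‖ := by
      change (q s : WeakDual ℝ X) x = ‖x‖
      rw [hs]
      exact hgx
    rw [h2] at h
    simpa using h

/-! ### Lipschitz estimates -/

/-- Bounded functions are Lipschitz for the discrete metric. -/
theorem LscMetric.isLipschitzFun_discrete {K : Type*} [TopologicalSpace K] [T2Space K]
    [CompactSpace K] (f : C(K, ℝ)) : (LscMetric.discrete K).IsLipschitzFun f := by
  refine ⟨2 * ‖f‖, fun s t => ?_⟩
  by_cases h : s = t
  · simp [h, LscMetric.discrete]
  · have : (LscMetric.discrete K).d s t = 1 := by simp [LscMetric.discrete, h]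
    rw [this, mul_one]
    have h1 := ContinuousMap.norm_coe_le_norm f s
    have h2 := ContinuousMap.norm_coe_le_norm f t
    exact (norm_sub_le (f s) (f t)).trans (by linarith)

theorem LscMetric.d_nonneg {K : Type*} [TopologicalSpace K] (m : LscMetric K) (x y : K) :
    0 ≤ m.d x y := by
  have h := m.d_triangle x y x
  rw [m.d_self, m.d_comm y x] at h
  linarith

/-- A bounded operator into `C(K)` all of whose values are Lipschitz has uniformly bounded Lipschitz
constants. -/
theorem LscMetric.exists_uniform_lipschitz {K : Type*} [TopologicalSpace K] [CompactSpace K]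
    (m : LscMetric K) {X : Type*} [NormedAddCommGroup X] [NormedSpace ℝ X] [CompleteSpace X]
    (J : X →L[ℝ] C(K, ℝ)) (hJ : ∀ x, m.IsLipschitzFun (J x)) :
    ∃ L, 0 < L ∧ ∀ x s t, |J x s - J x t| ≤ L * ‖x‖ * m.d s t := by
  -- Difference quotients, to which uniform boundedness applies. On the diagonal the inverse is `0`.
  let g : K × K → X →L[ℝ] ℝ := fun p => (m.d p.1 p.2)⁻¹ •
    ((ContinuousMap.evalCLM ℝ p.1).comp J - (ContinuousMap.evalCLM ℝ p.2).comp J)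
  have hg : ∀ p x, g p x = (m.d p.1 p.2)⁻¹ * (J x p.1 - J x p.2) := fun p x => rfl
  obtain ⟨C, hC⟩ := banach_steinhaus (g := g) (fun x => by
    obtain ⟨L, hL⟩ := hJ x
    refine ⟨|L|, fun p => ?_⟩
    rw [hg, Real.norm_eq_abs, abs_mul, abs_inv, abs_of_nonneg (m.d_nonneg _ _)]
    refine inv_mul_le_of_le_mul₀ (m.d_nonneg _ _) (abs_nonneg _) ((hL _ _).trans ?_)
    rw [mul_comm]
    exact mul_le_mul_of_nonneg_left (le_abs_self L) (m.d_nonneg _ _))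
  refine ⟨|C| + 1, by positivity, fun x s t => ?_⟩
  rcases (m.d_nonneg s t).eq_or_lt' with h | h
  · rw [m.eq_of_d_eq_zero s t h]
    simp [m.d_self]
  · have h1 := (g (s, t)).le_of_opNorm_le (hC (s, t)) x
    rw [hg, Real.norm_eq_abs, abs_mul, abs_inv, abs_of_pos h, inv_mul_le_iff₀ h] at h1
    calc |J x s - J x t| ≤ m.d s t * (C * ‖x‖) := h1
      _ ≤ m.d s t * ((|C| + 1) * ‖x‖) := by
        gcongr
        linarith [le_abs_self C]
      _ = _ := by ring

/-- A Cantor set on which the metric is bounded above and bounded away from zero is equivalent to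
the Cantor space with the discrete metric. -/
theorem LscMetric.equivalent_cantorMetric_range {K : Type*} [TopologicalSpace K] [T2Space K]
    (m : LscMetric K) {f : CantorSpace → K} (hf : Continuous f) {a b : ℝ} (ha : 0 < a)
    (hlow : ∀ x y, x ≠ y → a ≤ m.d (f x) (f y)) (hup : ∀ x y, m.d (f x) (f y) ≤ b) :
    LscMetric.Equivalent (m.restrict (range f)) cantorMetric := by
  have hinj : Function.Injective f := by
    intro x y hxy
    by_contra hne
    have := hlow x y hne
    rw [hxy, m.d_self] at this
    linarith
  let e : CantorSpace ≃ₜ range f := (hf.isClosedEmbedding hinj).isEmbedding.toHomeomorph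
  have hd : ∀ x y : CantorSpace, x ≠ y → cantorMetric.d x y = 1 := fun x y h => by
    simp [LscMetric.discrete, h]
  have he : ∀ x y, (m.restrict (range f)).d (e x) (e y) = m.d (f x) (f y) := fun x y => rfl
  refine ⟨e.symm, ⟨a⁻¹, fun s t => ?_⟩, ⟨b, fun x y => ?_⟩⟩
  · obtain ⟨x, rfl⟩ := e.surjective s
    obtain ⟨y, rfl⟩ := e.surjective t
    rw [e.symm_apply_apply, e.symm_apply_apply, he]
    by_cases h : x = y
    · rw [h, m.d_self, cantorMetric.d_self, mul_zero]
    · rw [hd x y h, inv_mul_eq_div, one_le_div ha]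
      exact hlow x y h
  · change (m.restrict (range f)).d (e x) (e y) ≤ _
    rw [he]
    by_cases h : x = y
    · rw [h, m.d_self, cantorMetric.d_self, mul_zero]
    · rw [hd x y h, mul_one]
      exact hup x y

/-! ### Extraction of the Cantor set -/

/-- An isomorphic copy of `C(CantorSpace, ℝ)` consisting of Lipschitz functions yields a copy of the
Cantor space. -/
theorem LscMetric.exists_equivalent_cantorMetric {K : Type*} [TopologicalSpace K] [CompactSpace K]
    [TopologicalSpace.MetrizableSpace K] (m : LscMetric K)
    (h : m.ContainsIsomorphicLipschitzCopy C(CantorSpace, ℝ)) :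
    ∃ H : Set K, LscMetric.Equivalent (m.restrict H) cantorMetric := by
  obtain ⟨J, ⟨c, hc, hJ⟩, hLip⟩ := h
  obtain ⟨L, hL, hJL⟩ := m.exists_uniform_lipschitz J hLip
  choose t δ' hδ' hfreq using exists_frequently_le_abs_apply J hc hJ
  let p : K := t fun _ => false
  -- Countably many pairs `(k, N)` cover the uncountable Cantor space, so one pair fixes both an
  -- atom size and a radius for uncountably many `s`.
  obtain ⟨k, N, hkN⟩ : ∃ k N : ℕ, ¬ {s | 1 / ((k : ℝ) + 1) < δ' s ∧ m.d p (t s) ≤ N}.Countable := by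
    by_contra! hcon
    have : Uncountable CantorSpace := by
      rw [← Cardinal.aleph0_lt_mk_iff]
      simpa using Cardinal.cantor Cardinal.aleph0
    refine not_countable_univ (α := CantorSpace)
      ((countable_iUnion fun k => countable_iUnion fun N => hcon k N).mono fun s _ => ?_)
    obtain ⟨k, hk⟩ := exists_nat_one_div_lt (hδ' s)
    obtain ⟨N, hN⟩ := exists_nat_ge (m.d p (t s))
    exact mem_iUnion.2 ⟨k, mem_iUnion.2 ⟨N, hk, hN⟩⟩
  set δ : ℝ := 1 / ((k : ℝ) + 1) with hδdef
  have hδ : 0 < δ := Nat.one_div_pos_of_nat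
  set S : Set CantorSpace := {s | δ < δ' s ∧ m.d p (t s) ≤ N} with hS
  let R : Set (K × K) := {q | ∃ f : C(CantorSpace, ℝ), ‖f‖ ≤ 1 ∧ δ / 2 < |J f q.1 - J f q.2|}
  have hR : IsOpen R := by
    have : R = ⋃ f ∈ {f : C(CantorSpace, ℝ) | ‖f‖ ≤ 1}, {q | δ / 2 < |J f q.1 - J f q.2|} := by
      ext q
      simp [R]
    rw [this]
    exact isOpen_biUnion fun f _ => isOpen_lt (by fun_prop) (by fun_prop)
  let C : Set K := {x | m.d p x ≤ N}
  -- Lower semicontinuity closes the `d`-ball in the compact topology, so the limit points of the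
  -- scheme stay in it.
  have hC : IsClosed C :=
    (m.lsc.comp (g := fun x : K => (p, x)) (by fun_prop)).isClosed_preimage N
  let := TopologicalSpace.metrizableSpaceMetric K
  obtain ⟨f, hf, hfC, hfR⟩ := exists_cantor_pairwise_related (fun s : S => t s) hR
    (fun x y ⟨f, hf, hxy⟩ => ⟨f, hf, by rwa [abs_sub_comm]⟩)
    (fun i => by
      -- If `j` is not an atom of `ν` of size `δ / 2`, some cylinder indicator at `j` is mapped to a
      -- function exceeding `δ` in modulus at `t j` and below `δ / 2` at `t i`, so the pair is in
      -- `R`.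
      let ν := (ContinuousMap.evalCLM ℝ (t i)).comp J
      refine (((finite_setOf_frequently_le_abs ν (half_pos hδ)).preimage
        Subtype.val_injective.injOn).subset fun j hj => ?_).countable
      refine (hfreq j).mono fun n hn => ?_
      change δ / 2 ≤ |J (cylinderIndicator j n) (t i)|
      by_contra! hlt
      refine hj ⟨cylinderIndicator j n, norm_cylinderIndicator_le _ _, ?_⟩
      have h1 := abs_sub_abs_le_abs_sub (J (cylinderIndicator j n) (t j))
        (J (cylinderIndicator j n) (t i))
      rw [abs_sub_comm] at h1
      have h2 : δ < δ' j := j.2.1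
      linarith) hC
    (fun hcount => hkN (by
      have : {i : S | t i ∈ C} = univ := eq_univ_of_forall fun i => i.2.2
      rw [this, countable_univ_iff] at hcount
      exact hcount))
  refine ⟨range f, m.equivalent_cantorMetric_range hf (a := δ / 2 / L) (b := N + N)
    (by positivity) (fun x y hxy => ?_) (fun x y => ?_)⟩
  · obtain ⟨g, hg, hgR⟩ := hfR x y hxy
    rw [div_le_iff₀ hL]
    have h1 := hJL g (f x) (f y)
    have h2 : L * ‖g‖ * m.d (f x) (f y) ≤ L * 1 * m.d (f x) (f y) := by
      gcongr
      exact m.d_nonneg _ _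
    linarith
  · have h1 := m.d_triangle (f x) p (f y)
    rw [m.d_comm (f x) p] at h1
    have h2 : m.d p (f x) ≤ N := hfC x
    have h3 : m.d p (f y) ≤ N := hfC y
    linarith

theorem proposition5p9 :
    LscMetric.IsometricLipschitzUniversal.{u} cantorMetric ∧
    ∀ (K : Type v) [TopologicalSpace K] [CompactSpace K] [TopologicalSpace.MetrizableSpace K]
      (m : LscMetric K), LscMetric.IsomorphicLipschitzUniversal.{u} m →
      ∃ H : Set K, LscMetric.Equivalent (m.restrict H) cantorMetric := by
  refine ⟨fun X _ _ _ _ => ?_, fun K _ _ _ m hm => m.exists_equivalent_cantorMetric ?_⟩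
  · obtain ⟨J⟩ := exists_linearIsometry_continuousMap_cantorSpace X
    exact ⟨J, fun x => LscMetric.isLipschitzFun_discrete (J x)⟩
  -- Universality quantifies over spaces in universe `u`, so the test space is lifted there.
  · have : TopologicalSpace.SeparableSpace (ULift.{u} C(CantorSpace, ℝ)) :=
      Homeomorph.ulift.symm.surjective.denseRange.separableSpace Homeomorph.ulift.symm.continuous
    obtain ⟨J, ⟨c, hc, hJ⟩, hLip⟩ := hm (ULift.{u} C(CantorSpace, ℝ))
    let e : ULift.{u} C(CantorSpace, ℝ) ≃L[ℝ] C(CantorSpace, ℝ) := ContinuousLinearEquiv.ulift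
    exact ⟨J.comp e.symm.toContinuousLinearMap, ⟨c, hc, fun f => hJ (ULift.up f)⟩,
      fun f => hLip (ULift.up f)⟩
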